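/- Let $E$ be a complex Banach space of dimension at least three (possibly infinite), let $\mathcal B(E)$ be the algebra of bounded linear operators on $E$, and let $\mathcal F(E)$ be its subalgebra of bounded operators with finite-dimensional range. Let $\mathcal A$ be a standard operator algebra on $E$, that is, a (not necessarily unital or closed) complex subalgebra of $\mathcal B(E)$ containing $\mathcal F(E)$. Let $\phi\colon\mathcal A\to\mathcal A$ be a map (not assumed linear, additive, multiplicative or continuous) whose range contains all rank-one idempotents, i.e. all $q\in\mathcal B(E)$ with $q^2=q$ and $\dim q(E)=1$. Suppose that for all $a,b\in\mathcal A$ there is an algebra automorphism $\theta_{a,b}$ of $\mathcal A$ (a complex-linear multiplicative bijection $\mathcal A\to\mathcal A$), depending on $a$ and $b$, such that $$\phi(a)+\phi(b)=\theta_{a,b}(a+b).$$ Then $\phi$ maps $\mathcal F(E)$ into itself, and the restriction $\phi|_{\mathcal F(E)}$ is an algebra automorphism or an algebra anti-automorphism of $\mathcal F(E)$, i.e. a complex-linear bijection of $\mathcal F(E)$ onto itself that either preserves all products or reverses all products. If, moreover, $\phi$ is continuous with respect to the weak operator topology on $\mathcal A$ (the topology induced by the functions $T\mapsto f(Tx)$,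 $x\in E$, $f$ in the Banach dual $E'$ of $E$), then $\phi$ is an algebra homomorphism or an algebra anti-homomorphism of $\mathcal A$, i.e. $\phi$ is complex-linear on $\mathcal A$ and either preserves all products or reverses all products. -/

import Mathlib

open scoped Topology

namespace OperatorAlgebra

section Algebra

variable {B C : Type*} [NonUnitalRing B] [Module ℂ B] [NonUnitalRing C] [Module ℂ C]

/-- An algebra homomorphism: a complex-linear multiplicative map (no unit is assumed). -/
def IsAlgHom (f : B → C) : Prop :=
  IsLinearMap ℂ f ∧ ∀ x y, f (x * y) = f x * f y

/-- An algebra anti-homomorphism: a complex-linear map that reverses products. -/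
def IsAlgAntiHom (f : B → C) : Prop :=
  IsLinearMap ℂ f ∧ ∀ x y, f (x * y) = f y * f x

/-- An algebra automorphism: a bijective algebra homomorphism of `B` to itself. -/
def IsAlgAut (f : B → B) : Prop :=
  IsAlgHom f ∧ Function.Bijective f

/-- An algebra anti-automorphism: a bijective algebra anti-homomorphism of `B` to itself. -/
def IsAlgAntiAut (f : B → B) : Prop :=
  IsAlgAntiHom f ∧ Function.Bijective f

end Algebra

section Operators

variable (E : Type*) [NormedAddCommGroup E] [NormedSpace ℂ E]

/-- The algebra of bounded operators on `E` whose range is finite-dimensional. -/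
def finiteRank : NonUnitalSubalgebra ℂ (E →L[ℂ] E) where
  carrier := {T | FiniteDimensional ℂ T.range}
  zero_mem' := by
    have h : (0 : E →L[ℂ] E).range = ⊥ := by
      ext x
      simp
    rw [Set.mem_ofPred_eq, h]
    infer_instance
  add_mem' := by
    intro S T (hS : FiniteDimensional ℂ S.range) (hT : FiniteDimensional ℂ T.range)
    have h : (S + T).range ≤ S.range ⊔ T.range := by
      rintro _ ⟨x, rfl⟩
      exact Submodule.add_mem_sup ⟨x, rfl⟩ ⟨x, rfl⟩
    exact Submodule.finiteDimensional_of_le h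
  smul_mem' := by
    intro c T (hT : FiniteDimensional ℂ T.range)
    have h : (c • T).range ≤ T.range := by
      rintro _ ⟨x, rfl⟩
      exact ⟨c • x, by simp⟩
    exact Submodule.finiteDimensional_of_le h
  mul_mem' := by
    intro S T (hS : FiniteDimensional ℂ S.range) _
    have h : (S * T).range ≤ S.range := by
      rintro _ ⟨x, rfl⟩
      exact ⟨T x, rfl⟩
    exact Submodule.finiteDimensional_of_le h

variable {E}

/-- A standard operator algebra: a subalgebra of the bounded operators (neither unital nor closed
in general) that contains every bounded finite rank operator. -/
def IsStandard (A : NonUnitalSubalgebra ℂ (E →L[ℂ] E)) : Prop :=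
  finiteRank E ≤ A

/-- A rank one idempotent: a bounded operator `Q` with `Q * Q = Q` and one-dimensional range. -/
def IsRankOneIdempotent (Q : E →L[ℂ] E) : Prop :=
  IsIdempotentElem Q ∧ Module.finrank ℂ Q.range = 1

/-- The weak operator topology, restricted to a subalgebra of the bounded operators. -/
@[reducible]
noncomputable def wot (A : NonUnitalSubalgebra ℂ (E →L[ℂ] E)) : TopologicalSpace A :=
  TopologicalSpace.induced
    (fun T : A => (ContinuousLinearMapWOT.ofCLM (T : E →L[ℂ] E) : E →WOT[ℂ] E)) inferInstance

end Operators

end OperatorAlgebra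

/-! Taking `b = a` gives `φ a = θ a` for an automorphism `θ`. Rank one idempotents are the minimal
idempotents of `A`, so automorphisms permute them; as they span the finite rank operators,
automorphisms preserve finite rank and trace. Comparing traces of squares of `φ a + φ b = θ (a + b)`
gives `tr (φ a * φ b) = tr (a * b)`. The trace form is nondegenerate and the range spans, so `φ` is
linear on finite rank operators. Polarising `tr ((φ a)^3) = tr (a^3)` then yields `φ (a^2) = (φ
a)^2`, and Herstein's theorem on Jordan maps onto prime rings finishes the first claim
(`isAlgAut_or_isAlgAntiAut_of_trace`). The second follows by weak operator density of the finite
rank operators. -/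

namespace OperatorAlgebra

/-! ### Jordan homomorphisms onto prime rings -/

section Jordan

variable {R : Type*} [NonUnitalRing R]

/-- Primeness of a ring, expressed through elements. -/
def IsPrimeRing (R : Type*) [NonUnitalRing R] : Prop :=
  ∀ a b : R, (∀ r, a * r * b = 0) → a = 0 ∨ b = 0

/-- A symmetric product vanishing identically forces one factor to vanish in a prime ring. -/
theorem IsPrimeRing.eq_zero_or_eq_zero_of_add_eq_zero (hR : IsPrimeRing R)
    (h2 : ∀ x : R, x + x = 0 → x = 0) {a b : R} (h : ∀ r, a * r * b + b * r * a = 0) :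
    a = 0 ∨ b = 0 := by
  refine hR a b fun r => ?_
  have h' : ∀ r, a * r * b = -(b * r * a) := fun r => eq_neg_of_add_eq_zero_left (h r)
  -- Exchanging `a` and `b` three times costs three signs and returns the same word.
  have key : ∀ s, (a * r * b) * s * (a * r * b) = 0 := by
    intro s
    apply h2
    have e1 : (a * r * b) * s * (a * r * b) = -(b * (r * a * s) * a) * (r * b) := by
      have : (a * r * b) * s * (a * r * b) = (a * r * b) * (s * a * (r * b)) := by
        simp only [mul_assoc]
      rw [this, h' r]
      simp only [neg_mul, mul_assoc]
    have e2 : -(b * (r * a * s) * a) * (r * b) = a * r * (a * s * b) * (r * b) := by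
      rw [← h' (r * a * s)]
      simp only [mul_assoc]
    have e3 : a * r * (a * s * b) * (r * b) = -((a * r * b) * s * (a * r * b)) := by
      rw [h' s]
      simp only [neg_mul, mul_neg, mul_assoc]
    exact add_eq_zero_iff_eq_neg.2 (e1.trans (e2.trans e3))
  rcases hR _ _ key with h | h <;> exact h

/-- If two subgroups cover an additive group, one of them is the whole group. -/
theorem forall_or_forall_of_addSubgroup {G : Type*} [AddGroup G] (H K : AddSubgroup G)
    (h : ∀ x, x ∈ H ∨ x ∈ K) : (∀ x, x ∈ H) ∨ ∀ x, x ∈ K := by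
  by_contra! hc
  obtain ⟨⟨x, hx⟩, y, hy⟩ := hc
  have hxK := (h x).resolve_left hx
  have hyH := (h y).resolve_right hy
  rcases h (x + y) with h | h
  · exact hx ((H.add_mem_cancel_right hyH).1 h)
  · exact hy ((K.add_mem_cancel_left hxK).1 h)

/-- **Herstein's theorem**: a surjective Jordan homomorphism onto a prime ring without 2-torsion is
multiplicative or reverses products. -/
theorem map_mul_or_map_mul_rev_of_jordan {S : Type*} [NonUnitalRing S]
    (hR : IsPrimeRing R) (h2 : ∀ x : R, x + x = 0 → x = 0) (f : S →+ R)
    (hf : Function.Surjective f) (hsq : ∀ a, f (a * a) = f a * f a) :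
    (∀ a b, f (a * b) = f a * f b) ∨ ∀ a b, f (a * b) = f b * f a := by
  have cancel : ∀ x y : R, x + x = y + y → x = y := fun x y h => by
    refine sub_eq_zero.1 (h2 _ ?_)
    rw [← sub_eq_zero] at h
    rw [← h]; abel
  have hJ : ∀ a b, f (a * b) + f (b * a) = f a * f b + f b * f a := by
    intro a b
    have := hsq (a + b)
    simp only [mul_add, add_mul, map_add, hsq] at this
    rw [← sub_eq_zero] at this ⊢
    rw [← this]; abel
  have hU : ∀ a b, f (a * b * a) = f a * f b * f a := by
    intro a b
    -- With `x ∘ y = x * y + y * x`, one has `a ∘ (a ∘ b) - a^2 ∘ b = 2 a b a`.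
    apply cancel
    have h1 := hJ a (a * b + b * a)
    have h3 := hJ (a * a) b
    simp only [mul_add, add_mul, map_add, hsq] at h1 h3
    have h4 : f (a * b) = f a * f b + f b * f a - f (b * a) := eq_sub_of_add_eq (hJ a b)
    rw [h4] at h1
    simp only [mul_add, add_mul, mul_sub, sub_mul, mul_assoc] at h1 h3 ⊢
    rw [← sub_eq_zero] at h1 h3 ⊢
    have := congrArg₂ (· - ·) h1 h3
    simp only [sub_zero] at this
    rw [← this]; abel
  have hT : ∀ a b c, f (a * b * c) + f (c * b * a) = f a * f b * f c + f c * f b * f a := by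
    intro a b c
    have := hU (a + c) b
    simp only [mul_add, add_mul, map_add, hU] at this
    rw [← sub_eq_zero] at this ⊢
    rw [← this]; abel
  have hpt : ∀ a b, f (a * b) = f a * f b ∨ f (a * b) = f b * f a := by
    intro a b
    rw [← sub_eq_zero, ← sub_eq_zero (a := f (a * b)) (b := f b * f a)]
    refine hR.eq_zero_or_eq_zero_of_add_eq_zero h2 fun r' => ?_
    obtain ⟨r, rfl⟩ := hf r'
    -- Compute `f` of `(ab)r(ba) + (ba)r(ab)` twice: by `hT`, and, regrouped as `a(brb)a + b(ara)b`,
    -- by `hU`.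
    have h1 := hT (a * b) r (b * a)
    have h3 : f (a * b * r * (b * a)) + f (b * a * r * (a * b))
        = f a * (f b * f r * f b) * f a + f b * (f a * f r * f a) * f b := by
      rw [← hU b r, ← hU a r, ← hU, ← hU]
      simp only [mul_assoc]
    rw [h3, eq_sub_of_add_eq' (hJ a b)] at h1
    simp only [mul_add, add_mul, mul_sub, sub_mul, mul_assoc] at h1 ⊢
    rw [← sub_eq_zero] at h1
    rw [← h1]; abel
  -- The pointwise alternative becomes uniform by covering with two subgroups, once in `b` and once
  -- in `a`.
  let H (a : S) : AddSubgroup S := ((f.comp (AddMonoidHom.mulLeft a)).eqLocus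
    ((AddMonoidHom.mulLeft (f a)).comp f))
  let K (a : S) : AddSubgroup S := ((f.comp (AddMonoidHom.mulLeft a)).eqLocus
    ((AddMonoidHom.mulRight (f a)).comp f))
  have hHK : ∀ a, (∀ b, b ∈ H a) ∨ ∀ b, b ∈ K a := fun a =>
    forall_or_forall_of_addSubgroup (H a) (K a) (hpt a)
  let H' : AddSubgroup S :=
    { carrier := {a | ∀ b, f (a * b) = f a * f b}
      zero_mem' := by simp
      add_mem' := fun {x y} hx hy b => by
        simp only [add_mul, map_add, hx b, hy b]
      neg_mem' := fun {x} hx b => by simp only [neg_mul, map_neg, hx b] }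
  let K' : AddSubgroup S :=
    { carrier := {a | ∀ b, f (a * b) = f b * f a}
      zero_mem' := by simp
      add_mem' := fun {x y} hx hy b => by
        simp only [add_mul, mul_add, map_add, hx b, hy b]
      neg_mem' := fun {x} hx b => by simp only [neg_mul, mul_neg, map_neg, hx b] }
  exact forall_or_forall_of_addSubgroup H' K' hHK

end Jordan

/-! ### Maps controlled by a nondegenerate trace -/

section Trace

variable {R : Type*} [NonUnitalRing R] [Module ℂ R] [IsScalarTower ℂ R R] [SMulCommClass ℂ R R]

/-- On a prime algebra with a nondegenerate trace, a map whose pairwise sums agree with values of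
trace preserving homomorphisms, and whose range spans, is an automorphism or anti-automorphism. -/
theorem isAlgAut_or_isAlgAntiAut_of_trace (hR : IsPrimeRing R) (τ : R →ₗ[ℂ] ℂ)
    (hτ : ∀ a b, τ (a * b) = τ (b * a)) (hnd : ∀ a, (∀ b, τ (a * b) = 0) → a = 0)
    (ψ : R → R) (hspan : Submodule.span ℂ (Set.range ψ) = ⊤)
    (hψ : ∀ a b, ∃ θ : R → R, IsAlgAut θ ∧ (∀ x, τ (θ x) = τ x) ∧ ψ a + ψ b = θ (a + b)) :
    IsAlgAut ψ ∨ IsAlgAntiAut ψ := by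
  have two_cancel : ∀ x : R, x + x = 0 → x = 0 := fun x h => by
    rw [← two_smul ℂ] at h
    exact (smul_eq_zero_iff_right two_ne_zero).1 h
  have hpt : ∀ a, ∃ θ : R → R, IsAlgAut θ ∧ (∀ x, τ (θ x) = τ x) ∧ ψ a = θ a := by
    intro a
    obtain ⟨θ, h1, h2, h3⟩ := hψ a a
    refine ⟨θ, h1, h2, ?_⟩
    rw [h1.1.1.map_add] at h3
    refine sub_eq_zero.1 (two_cancel _ ?_)
    rw [← sub_eq_zero] at h3
    rw [← h3]; abel
  have hsq : ∀ a, τ (ψ a * ψ a) = τ (a * a) := by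
    intro a
    obtain ⟨θ, h1, h2, h3⟩ := hpt a
    rw [h3, ← h1.1.2, h2]
  have hcube : ∀ a, τ (ψ a * ψ a * ψ a) = τ (a * a * a) := by
    intro a
    obtain ⟨θ, h1, h2, h3⟩ := hpt a
    rw [h3, ← h1.1.2, ← h1.1.2, h2]
  have hmul : ∀ a b, τ (ψ a * ψ b) = τ (a * b) := by
    intro a b
    obtain ⟨θ, h1, h2, h3⟩ := hψ a b
    have h4 : τ ((ψ a + ψ b) * (ψ a + ψ b)) = τ ((a + b) * (a + b)) := by
      rw [h3, ← h1.1.2, h2]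
    simp only [mul_add, add_mul, map_add, hsq] at h4
    rw [hτ b a, hτ (ψ b) (ψ a)] at h4
    linear_combination h4 / 2
  -- Since values of `ψ` span, they suffice as test elements; this turns trace identities into
  -- operator identities.
  have hzero : ∀ a, (∀ b, τ (a * ψ b) = 0) → a = 0 := by
    intro a ha
    refine hnd a fun b => ?_
    have : b ∈ Submodule.span ℂ (Set.range ψ) := hspan ▸ Submodule.mem_top
    induction this using Submodule.span_induction with
    | mem x hx => obtain ⟨b, rfl⟩ := hx; exact ha b
    | zero => simp
    | add x y _ _ hx hy => rw [mul_add, map_add, hx, hy, add_zero]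
    | smul c x _ hx => rw [mul_smul_comm, map_smul, hx, smul_zero]
  have hlin : IsLinearMap ℂ ψ := by
    constructor
    · intro a b
      refine sub_eq_zero.1 (hzero _ fun c => ?_)
      simp only [sub_mul, add_mul, map_sub, map_add, hmul]
      ring
    · intro k a
      refine sub_eq_zero.1 (hzero _ fun c => ?_)
      simp only [sub_mul, map_sub, hmul, smul_mul_assoc, map_smul, sub_self]
  let Ψ : R →ₗ[ℂ] R := hlin.mk'
  have hbij : Function.Bijective ψ := by
    constructor
    · refine (injective_iff_map_eq_zero Ψ).2 fun a ha => ?_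
      obtain ⟨θ, h1, -, h3⟩ := hpt a
      refine h1.2.1 ?_
      rw [← h3, h1.1.1.map_zero]; exact ha
    · have h : LinearMap.range Ψ = ⊤ := by
        rw [← hspan]
        refine le_antisymm ?_ (Submodule.span_le.2 ?_)
        · rintro _ ⟨x, rfl⟩
          exact Submodule.subset_span ⟨x, rfl⟩
        · rintro _ ⟨x, rfl⟩
          exact ⟨x, rfl⟩
      exact LinearMap.range_eq_top.1 h
  have hpol : ∀ a b : R, τ ((a + b) * (a + b) * (a + b)) - τ ((a - b) * (a - b) * (a - b))
      = 6 * τ (a * a * b) + 2 * τ (b * b * b) := by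
    intro a b
    have e1 : τ (a * b * a) = τ (a * a * b) := by rw [hτ, ← mul_assoc]
    have e2 : τ (b * a * a) = τ (a * a * b) := by rw [mul_assoc, hτ]
    simp only [mul_add, add_mul, mul_sub, sub_mul, map_add, map_sub, e1, e2]
    ring
  have hjordan : ∀ a, ψ (a * a) = ψ a * ψ a := by
    intro a
    refine sub_eq_zero.1 (hzero _ fun b => ?_)
    have h1 := hpol a b
    -- Polarised on both sides, the cubes give `τ (ψ a * ψ a * ψ b) = τ (a * a * b)`, which `hmul`
    -- equates with `τ (ψ (a * a) * ψ b)`.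
    rw [← hcube (a + b), ← hcube (a - b), hlin.map_add, hlin.map_sub, hpol, hcube] at h1
    rw [sub_mul, map_sub, hmul]
    linear_combination -h1 / 6
  rcases map_mul_or_map_mul_rev_of_jordan hR two_cancel Ψ.toAddMonoidHom hbij.2 hjordan with h | h
  · exact Or.inl ⟨⟨hlin, h⟩, hbij⟩
  · exact Or.inr ⟨⟨hlin, h⟩, hbij⟩

end Trace

end OperatorAlgebra

namespace OperatorAlgebra

/-! ### Finite rank operators and their trace -/

section Operators

variable {E : Type*} [NormedAddCommGroup E] [NormedSpace ℂ E]

theorem mem_finiteRank_of_forall_mem {T : E →L[ℂ] E} (W : Submodule ℂ E) [FiniteDimensional ℂ W]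
    (h : ∀ x, T x ∈ W) : T ∈ finiteRank E := by
  have : T.range ≤ W := by
    rintro _ ⟨x, rfl⟩
    exact h x
  exact Submodule.finiteDimensional_of_le this

theorem smulRight_mem_finiteRank (f : E →L[ℂ] ℂ) (x : E) : f.smulRight x ∈ finiteRank E :=
  mem_finiteRank_of_forall_mem (ℂ ∙ x) fun _ =>
    Submodule.smul_mem _ _ (Submodule.mem_span_singleton_self x)

/-- The rank one operator `y ↦ f y • x` as a finite rank operator. -/
noncomputable def rankOne (f : E →L[ℂ] ℂ) (x : E) : finiteRank E :=
  ⟨f.smulRight x, smulRight_mem_finiteRank f x⟩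

@[simp]
theorem rankOne_apply (f : E →L[ℂ] ℂ) (x y : E) : (rankOne f x : E →L[ℂ] E) y = f y • x := rfl

theorem exists_dual_eq_one {x : E} (hx : x ≠ 0) : ∃ f : E →L[ℂ] ℂ, f x = 1 :=
  SeparatingDual.exists_eq_one hx

theorem isRankOneIdempotent_iff {Q : E →L[ℂ] E} :
    IsRankOneIdempotent Q ↔ ∃ (f : E →L[ℂ] ℂ) (x : E), f x = 1 ∧ Q = f.smulRight x := by
  constructor
  · rintro ⟨hQ, hr⟩
    obtain ⟨⟨x, hx⟩, hx0, hspan⟩ := finrank_eq_one_iff'.1 hr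
    have hx0' : x ≠ 0 := fun h => hx0 (Subtype.ext h)
    have hQx : Q x = x := by
      obtain ⟨y, rfl⟩ := hx
      exact congrArg (fun S : E →L[ℂ] E => S y) hQ
    obtain ⟨g, hg⟩ := exists_dual_eq_one hx0'
    refine ⟨g.comp Q, x, by simp [hQx, hg], ?_⟩
    ext y
    obtain ⟨c, hc⟩ := hspan ⟨Q y, y, rfl⟩
    have hc' : c • x = Q y := congrArg Subtype.val hc
    simp [← hc', hg]
  · rintro ⟨f, x, hfx, rfl⟩
    have hx0 : x ≠ 0 := by
      rintro rfl
      simp at hfx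
    refine ⟨?_, finrank_eq_one_iff'.2 ⟨⟨x, x, by simp [hfx]⟩, ?_, ?_⟩⟩
    · ext y
      simp [hfx]
    · exact fun h => hx0 (congrArg Subtype.val h)
    · rintro ⟨_, y, rfl⟩
      exact ⟨f y, rfl⟩

theorem isRankOneIdempotent_rankOne {f : E →L[ℂ] ℂ} {x : E} (h : f x = 1) :
    IsRankOneIdempotent (rankOne f x : E →L[ℂ] E) :=
  isRankOneIdempotent_iff.2 ⟨f, x, h, rfl⟩

/-- A finite-dimensional subspace is the range of a bounded projection. -/
theorem exists_projection_onto (W : Submodule ℂ E) [FiniteDimensional ℂ W] :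
    ∃ P : E →L[ℂ] E, (∀ x, P x ∈ W) ∧ ∀ x ∈ W, P x = x := by
  obtain ⟨p, hp⟩ := Submodule.ClosedComplemented.of_finiteDimensional (𝕜 := ℂ) W
  refine ⟨W.subtypeL.comp p, fun x => (p x).2, fun x hx => ?_⟩
  exact congrArg Subtype.val (hp ⟨x, hx⟩)

theorem span_rankOne_eq_top :
    Submodule.span ℂ {T : finiteRank E | ∃ f x, T = rankOne f x} = ⊤ := by
  rw [eq_top_iff]
  rintro T -
  have hT : FiniteDimensional ℂ (T : E →L[ℂ] E).range := T.2
  set W := (T : E →L[ℂ] E).range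
  let b := Module.finBasis ℂ W
  obtain ⟨p, hp⟩ := Submodule.ClosedComplemented.of_finiteDimensional (𝕜 := ℂ) W
  have key : T = ∑ i, rankOne
      (((LinearMap.toContinuousLinearMap (b.coord i)).comp p).comp (T : E →L[ℂ] E)) (b i : E) := by
    ext y
    have h1 : p ((T : E →L[ℂ] E) y) = ⟨(T : E →L[ℂ] E) y, y, rfl⟩ := hp ⟨_, y, rfl⟩
    have h2 := congrArg Subtype.val (b.sum_repr ⟨(T : E →L[ℂ] E) y, y, rfl⟩)
    rw [AddSubmonoidClass.coe_finsetSum] at h2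
    simp only [AddSubmonoidClass.coe_finsetSum, sum_apply, rankOne_apply,
      ContinuousLinearMap.comp_apply, h1]
    exact h2.symm
  rw [key]
  exact Submodule.sum_mem _ fun i _ => Submodule.subset_span ⟨_, _, rfl⟩

/-- If `f x ≠ 0`, rescaling `f` makes `rankOne f x` idempotent; if `f x = 0` and `x ≠ 0`, write `f =
(f + g) - g` with `g x = 1`. -/
theorem span_isRankOneIdempotent_eq_top :
    Submodule.span ℂ {T : finiteRank E | IsRankOneIdempotent (T : E →L[ℂ] E)} = ⊤ := by
  rw [← top_le_iff, ← span_rankOne_eq_top, Submodule.span_le]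
  have main : ∀ (f : E →L[ℂ] ℂ) (x : E), f x ≠ 0 → rankOne f x ∈
      Submodule.span ℂ {T : finiteRank E | IsRankOneIdempotent (T : E →L[ℂ] E)} := by
    intro f x h
    have : rankOne f x = f x • rankOne ((f x)⁻¹ • f) x := by
      ext y
      simp [smul_smul, h]
    rw [this]
    exact Submodule.smul_mem _ _ (Submodule.subset_span
      (isRankOneIdempotent_rankOne (by simp [h])))
  rintro _ ⟨f, x, rfl⟩
  by_cases hx : x = 0
  · have : rankOne f x = 0 := by
      ext y
      simp [hx]
    rw [this]
    exact Submodule.zero_mem _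
  by_cases h : f x = 0
  · obtain ⟨g, hg⟩ := exists_dual_eq_one hx
    have : rankOne f x = rankOne (f + g) x - rankOne g x := by
      ext y
      simp [add_smul]
    rw [this]
    exact Submodule.sub_mem _ (main _ _ (by simp [h, hg])) (main _ _ (by simp [hg]))
  · exact main f x h

theorem isPrimeRing_finiteRank : IsPrimeRing (finiteRank E) := by
  intro a b h
  by_contra! hc
  obtain ⟨ha, hb⟩ := hc
  have hx : ∃ x, (a : E →L[ℂ] E) x ≠ 0 := by
    by_contra! hx
    exact ha (Subtype.ext (ContinuousLinearMap.ext hx))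
  have hy : ∃ y, (b : E →L[ℂ] E) y ≠ 0 := by
    by_contra! hy
    exact hb (Subtype.ext (ContinuousLinearMap.ext hy))
  obtain ⟨x, hx⟩ := hx
  obtain ⟨y, hy⟩ := hy
  obtain ⟨g, hg⟩ := exists_dual_eq_one hy
  have := congrArg (fun T : finiteRank E => (T : E →L[ℂ] E) y) (h (rankOne g x))
  simp [hg, hx] at this

/-- The trace of an operator on a finite-dimensional subspace containing its range. -/
noncomputable def traceOn (W : Submodule ℂ E) (T : E →L[ℂ] E) (h : ∀ x, T x ∈ W) : ℂ :=
  LinearMap.trace ℂ W ((T : E →ₗ[ℂ] E).restrict (p := W) (q := W) fun x _ => h x)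

theorem traceOn_add {W : Submodule ℂ E} {S T : E →L[ℂ] E} (hS : ∀ x, S x ∈ W)
    (hT : ∀ x, T x ∈ W) (hST : ∀ x, (S + T) x ∈ W) :
    traceOn W (S + T) hST = traceOn W S hS + traceOn W T hT :=
  map_add (LinearMap.trace ℂ W)
    (S.toLinearMap.restrict (p := W) (q := W) fun x _ => hS x)
    (T.toLinearMap.restrict (p := W) (q := W) fun x _ => hT x)

theorem traceOn_smul {W : Submodule ℂ E} {T : E →L[ℂ] E} (c : ℂ)
    (hT : ∀ x, T x ∈ W) (hcT : ∀ x, (c • T) x ∈ W) :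
    traceOn W (c • T) hcT = c * traceOn W T hT :=
  map_smul (LinearMap.trace ℂ W) c (T.toLinearMap.restrict (p := W) (q := W) fun x _ => hT x)

/-- On `W`, `T` is the inclusion of `V` after a map `W → V`; composing in the other order gives `T`
on `V`, with the same trace. -/
theorem traceOn_eq_of_le {V W : Submodule ℂ E} [FiniteDimensional ℂ W] (hVW : V ≤ W)
    (T : E →L[ℂ] E) (h : ∀ x, T x ∈ V) : traceOn V T h = traceOn W T fun x => hVW (h x) := by
  have : FiniteDimensional ℂ V := Submodule.finiteDimensional_of_le hVW
  let g : W →ₗ[ℂ] V := ((T : E →ₗ[ℂ] E).comp W.subtype).codRestrict V fun x => h x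
  exact LinearMap.trace_comp_comm' (R := ℂ) (Submodule.inclusion hVW) g

/-- The trace of a finite rank operator. -/
noncomputable def finiteRankTrace : finiteRank E →ₗ[ℂ] ℂ where
  toFun T := traceOn (T : E →L[ℂ] E).range T fun x => ⟨x, rfl⟩
  map_add' S T := by
    have hS : FiniteDimensional ℂ (S : E →L[ℂ] E).range := S.2
    have hT : FiniteDimensional ℂ (T : E →L[ℂ] E).range := T.2
    have hST : (S + T : E →L[ℂ] E).range ≤ (S : E →L[ℂ] E).range ⊔ (T : E →L[ℂ] E).range := by
      rintro _ ⟨x, rfl⟩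
      exact Submodule.add_mem_sup ⟨x, rfl⟩ ⟨x, rfl⟩
    have eS := traceOn_eq_of_le (le_sup_left : _ ≤ (S : E →L[ℂ] E).range ⊔
      (T : E →L[ℂ] E).range) S fun x => ⟨x, rfl⟩
    have eT := traceOn_eq_of_le (le_sup_right : _ ≤ (S : E →L[ℂ] E).range ⊔
      (T : E →L[ℂ] E).range) T fun x => ⟨x, rfl⟩
    have eST := traceOn_eq_of_le hST (S + T) fun x => ⟨x, rfl⟩
    exact (eST.trans (traceOn_add _ _ _)).trans (congrArg₂ (· + ·) eS eT).symm
  map_smul' c T := by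
    have hT : FiniteDimensional ℂ (T : E →L[ℂ] E).range := T.2
    have hc : (c • T : E →L[ℂ] E).range ≤ (T : E →L[ℂ] E).range := by
      rintro _ ⟨x, rfl⟩
      exact ⟨c • x, by simp⟩
    exact (traceOn_eq_of_le hc (c • T) fun x => ⟨x, rfl⟩).trans (traceOn_smul c _ _)

theorem finiteRankTrace_eq_traceOn (T : finiteRank E) (W : Submodule ℂ E) [FiniteDimensional ℂ W]
    (h : ∀ x, (T : E →L[ℂ] E) x ∈ W) : finiteRankTrace T = traceOn W T h :=
  traceOn_eq_of_le (by rintro _ ⟨x, rfl⟩; exact h x) _ _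

theorem finiteRankTrace_mul_comm (S T : finiteRank E) :
    finiteRankTrace (S * T) = finiteRankTrace (T * S) := by
  have hS : FiniteDimensional ℂ (S : E →L[ℂ] E).range := S.2
  have hT : FiniteDimensional ℂ (T : E →L[ℂ] E).range := T.2
  let W := (S : E →L[ℂ] E).range ⊔ (T : E →L[ℂ] E).range
  have hSW : ∀ x, (S : E →L[ℂ] E) x ∈ W := fun x => Submodule.mem_sup_left ⟨x, rfl⟩
  have hTW : ∀ x, (T : E →L[ℂ] E) x ∈ W := fun x => Submodule.mem_sup_right ⟨x, rfl⟩
  rw [finiteRankTrace_eq_traceOn (S * T) W fun x => hSW _,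
    finiteRankTrace_eq_traceOn (T * S) W fun x => hTW _]
  exact LinearMap.trace_mul_comm ℂ
    ((S : E →L[ℂ] E).toLinearMap.restrict (p := W) (q := W) fun x _ => hSW x)
    ((T : E →L[ℂ] E).toLinearMap.restrict (p := W) (q := W) fun x _ => hTW x)

theorem finiteRankTrace_rankOne (f : E →L[ℂ] ℂ) (x : E) : finiteRankTrace (rankOne f x) = f x := by
  have hx : ∀ y, (rankOne f x : E →L[ℂ] E) y ∈ ℂ ∙ x := fun _ =>
    Submodule.smul_mem _ _ (Submodule.mem_span_singleton_self x)
  rw [finiteRankTrace_eq_traceOn _ (ℂ ∙ x) hx]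
  let g : ℂ →ₗ[ℂ] (ℂ ∙ x : Submodule ℂ E) :=
    LinearMap.toSpanSingleton ℂ _ ⟨x, Submodule.mem_span_singleton_self x⟩
  have := LinearMap.trace_comp_comm' (R := ℂ) g ((f : E →ₗ[ℂ] ℂ).comp (ℂ ∙ x).subtype)
  refine Eq.trans ?_ (this.symm.trans ?_)
  · rfl
  · rw [LinearMap.trace_eq_matrix_trace ℂ (Module.Basis.singleton Unit ℂ)]
    simp [Matrix.trace, LinearMap.toMatrix_apply, g]

/-- Testing against `rankOne f x` gives trace `f (a x)`, and functionals separate points. -/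
theorem eq_zero_of_finiteRankTrace_mul (a : finiteRank E)
    (h : ∀ b, finiteRankTrace (a * b) = 0) : a = 0 := by
  ext x
  by_contra hx
  obtain ⟨f, hf⟩ := exists_dual_eq_one (x := (a : E →L[ℂ] E) x) hx
  have : a * rankOne f x = rankOne f ((a : E →L[ℂ] E) x) := by
    ext y
    simp
  have h' := h (rankOne f x)
  rw [this, finiteRankTrace_rankOne, hf] at h'
  exact one_ne_zero h'

theorem finiteRankTrace_of_isRankOneIdempotent {T : finiteRank E}
    (h : IsRankOneIdempotent (T : E →L[ℂ] E)) : finiteRankTrace T = 1 := by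
  obtain ⟨f, x, hfx, hT⟩ := isRankOneIdempotent_iff.1 h
  have : T = rankOne f x := Subtype.ext hT
  rw [this, finiteRankTrace_rankOne, hfx]

end Operators

end OperatorAlgebra

namespace OperatorAlgebra

/-! ### Automorphisms and density in standard operator algebras -/

section Algebra

variable {B : Type*} [NonUnitalRing B] [Module ℂ B]

/-- The inverse of an algebra automorphism. -/
theorem IsAlgAut.exists_inverse {θ : B → B} (h : IsAlgAut θ) :
    ∃ θ' : B → B, IsAlgAut θ' ∧ (∀ x, θ' (θ x) = x) ∧ ∀ x, θ (θ' x) = x := by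
  obtain ⟨θ', hl, hr⟩ := Function.bijective_iff_has_inverse.1 h.2
  refine ⟨θ', ⟨⟨⟨fun x y => ?_, fun c x => ?_⟩, fun x y => ?_⟩, ?_⟩, hl, hr⟩
  · apply h.2.1
    rw [h.1.1.map_add, hr, hr, hr]
  · apply h.2.1
    rw [h.1.1.map_smul, hr, hr]
  · apply h.2.1
    rw [h.1.2, hr, hr, hr]
  · exact Function.bijective_iff_has_inverse.2 ⟨θ, hr, hl⟩

end Algebra

section Standard

variable {E : Type*} [NormedAddCommGroup E] [NormedSpace ℂ E]
  {A : NonUnitalSubalgebra ℂ (E →L[ℂ] E)}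

/-- In a standard operator algebra the rank one idempotents are the minimal idempotents. -/
theorem IsStandard.isRankOneIdempotent_iff_minimal (hA : IsStandard A) (q : A) :
    IsRankOneIdempotent (q : E →L[ℂ] E) ↔
      q * q = q ∧ q ≠ 0 ∧ ∀ t : A, ∃ c : ℂ, q * t * q = c • q := by
  constructor
  · intro h
    obtain ⟨f, x, hfx, hq⟩ := isRankOneIdempotent_iff.1 h
    refine ⟨Subtype.ext h.1, ?_, fun t => ⟨f ((t : E →L[ℂ] E) x), ?_⟩⟩
    · rintro rfl
      have h0 := congrArg (fun T : E →L[ℂ] E => f (T x)) hq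
      simp [hfx] at h0
    · ext y
      simp [hq, smul_smul, mul_comm]
  · rintro ⟨hqq, hq0, hmin⟩
    have hqq' : ∀ y, (q : E →L[ℂ] E) ((q : E →L[ℂ] E) y) = (q : E →L[ℂ] E) y := fun y =>
      congrArg (fun T : A => (T : E →L[ℂ] E) y) hqq
    obtain ⟨z, hz⟩ : ∃ z, (q : E →L[ℂ] E) z ≠ 0 := by
      by_contra! h
      exact hq0 (Subtype.ext (ContinuousLinearMap.ext h))
    obtain ⟨f, hf⟩ := exists_dual_eq_one hz
    refine ⟨congrArg Subtype.val hqq, finrank_eq_one_iff'.2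
      ⟨⟨(q : E →L[ℂ] E) z, z, rfl⟩, fun h => hz (congrArg Subtype.val h), ?_⟩⟩
    rintro ⟨_, y, rfl⟩
    -- This test operator sends `q z` to `q y`, so minimality forces `q y = c • q z`.
    obtain ⟨c, hc⟩ := hmin ⟨rankOne f ((q : E →L[ℂ] E) y), hA (rankOne f _).2⟩
    refine ⟨c, Subtype.ext ?_⟩
    have := congrArg (fun T : A => (T : E →L[ℂ] E) z) hc
    simp [hf, hqq'] at this
    simpa using this.symm

/-- Minimality of an idempotent is purely algebraic, hence invariant under automorphisms. -/
theorem IsStandard.isRankOneIdempotent_map (hA : IsStandard A) {θ : A → A} (hθ : IsAlgAut θ) {q : A}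
    (hq : IsRankOneIdempotent (q : E →L[ℂ] E)) : IsRankOneIdempotent (θ q : E →L[ℂ] E) := by
  rw [hA.isRankOneIdempotent_iff_minimal] at hq ⊢
  obtain ⟨h1, h2, h3⟩ := hq
  refine ⟨by rw [← hθ.1.2, h1], fun h => h2 (hθ.2.1 (h.trans hθ.1.1.map_zero.symm)), fun t => ?_⟩
  obtain ⟨s, rfl⟩ := hθ.2.2 t
  obtain ⟨c, hc⟩ := h3 s
  exact ⟨c, by rw [← hθ.1.2, ← hθ.1.2, hc, hθ.1.1.map_smul]⟩

/-- Automorphisms of a standard operator algebra preserve finite rank operators and the trace. -/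
theorem IsStandard.exists_finiteRankTrace_eq (hA : IsStandard A) {θ : A → A} (hθ : IsAlgAut θ)
    (T : finiteRank E) : ∃ S : finiteRank E,
      (S : E →L[ℂ] E) = θ ⟨T, hA T.2⟩ ∧ finiteRankTrace S = finiteRankTrace T := by
  have : T ∈ Submodule.span ℂ {T : finiteRank E | IsRankOneIdempotent (T : E →L[ℂ] E)} := by
    rw [span_isRankOneIdempotent_eq_top]
    exact Submodule.mem_top
  induction this using Submodule.span_induction with
  | mem T hT =>
    have h := hA.isRankOneIdempotent_map hθ (q := ⟨T, hA T.2⟩) hT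
    obtain ⟨f, x, -, hfx⟩ := isRankOneIdempotent_iff.1 h
    refine ⟨⟨θ ⟨T, hA T.2⟩, by rw [hfx]; exact smulRight_mem_finiteRank f x⟩, rfl, ?_⟩
    rw [finiteRankTrace_of_isRankOneIdempotent hT, finiteRankTrace_of_isRankOneIdempotent h]
  | zero => exact ⟨0, (congrArg Subtype.val hθ.1.1.map_zero).symm, rfl⟩
  | add S T _ _ hS hT =>
    obtain ⟨S', hS1, hS2⟩ := hS
    obtain ⟨T', hT1, hT2⟩ := hT
    refine ⟨S' + T', ?_, by rw [map_add, map_add, hS2, hT2]⟩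
    have := congrArg Subtype.val (hθ.1.1.map_add ⟨S, hA S.2⟩ ⟨T, hA T.2⟩)
    exact (congrArg₂ (· + ·) hS1 hT1).trans this.symm
  | smul c T _ hT =>
    obtain ⟨T', hT1, hT2⟩ := hT
    refine ⟨c • T', ?_, by rw [map_smul, map_smul, hT2]⟩
    have := congrArg Subtype.val (hθ.1.1.map_smul c ⟨T, hA T.2⟩)
    exact (congrArg (c • ·) hT1).trans this.symm

/-- The restriction of an automorphism of a standard operator algebra to finite rank operators. -/
theorem IsStandard.exists_isAlgAut_finiteRank (hA : IsStandard A) {θ : A → A} (hθ : IsAlgAut θ) :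
    ∃ θF : finiteRank E → finiteRank E, IsAlgAut θF ∧
      (∀ T, finiteRankTrace (θF T) = finiteRankTrace T) ∧
      ∀ T : finiteRank E, (θF T : E →L[ℂ] E) = θ ⟨T, hA T.2⟩ := by
  obtain ⟨θ', hθ', hl, hr⟩ := hθ.exists_inverse
  choose θF h1 h2 using hA.exists_finiteRankTrace_eq hθ
  choose θF' h1' h2' using hA.exists_finiteRankTrace_eq hθ'
  refine ⟨θF, ⟨⟨⟨fun S T => Subtype.ext ?_, fun c T => Subtype.ext ?_⟩,
    fun S T => Subtype.ext ?_⟩, Function.bijective_iff_has_inverse.2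
      ⟨θF', fun T => Subtype.ext ?_, fun T => Subtype.ext ?_⟩⟩, h2, h1⟩
  · have := congrArg Subtype.val (hθ.1.1.map_add ⟨S, hA S.2⟩ ⟨T, hA T.2⟩)
    exact (h1 _).trans (this.trans (congrArg₂ (· + ·) (h1 S) (h1 T)).symm)
  · have := congrArg Subtype.val (hθ.1.1.map_smul c ⟨T, hA T.2⟩)
    exact (h1 _).trans (this.trans (congrArg (c • ·) (h1 T)).symm)
  · have := congrArg Subtype.val (hθ.1.2 ⟨S, hA S.2⟩ ⟨T, hA T.2⟩)
    exact (h1 _).trans (this.trans (congrArg₂ (· * ·) (h1 S) (h1 T)).symm)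
  · have e : (⟨θF T, hA (θF T).2⟩ : A) = θ ⟨T, hA T.2⟩ := Subtype.ext (h1 T)
    rw [h1', e, hl]
  · have e : (⟨θF' T, hA (θF' T).2⟩ : A) = θ' ⟨T, hA T.2⟩ := Subtype.ext (h1' T)
    rw [h1, e, hr]

theorem IsAlgAut.map_eq_of_add_self {B : Type*} [NonUnitalRing B] [Module ℂ B] {θ : B → B}
    (hθ : IsAlgAut θ) {a b : B} (h : b + b = θ (a + a)) : b = θ a := by
  rw [hθ.1.1.map_add, ← two_smul ℂ b, ← two_smul ℂ (θ a)] at h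
  exact (smul_right_injective B (two_ne_zero (α := ℂ))) h

theorem IsStandard.exists_restrict_finiteRank (hA : IsStandard A) (φ : A → A)
    (hrange : ∀ Q : E →L[ℂ] E, IsRankOneIdempotent Q → ∃ a : A, (φ a : E →L[ℂ] E) = Q)
    (hφ : ∀ a b : A, ∃ θ : A → A, IsAlgAut θ ∧ φ a + φ b = θ (a + b)) :
    ∃ ψ : finiteRank E → finiteRank E,
      (∀ T : finiteRank E, (ψ T : E →L[ℂ] E) = (φ ⟨(T : E →L[ℂ] E), hA T.2⟩ : E →L[ℂ] E)) ∧
      (IsAlgAut ψ ∨ IsAlgAntiAut ψ) := by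
  have hpt : ∀ a : A, ∃ θ : A → A, IsAlgAut θ ∧ φ a = θ a := fun a => by
    obtain ⟨θ, hθ, h⟩ := hφ a a
    exact ⟨θ, hθ, hθ.map_eq_of_add_self h⟩
  have hmem : ∀ T : finiteRank E, ∃ S : finiteRank E, (S : E →L[ℂ] E) = φ ⟨T, hA T.2⟩ := by
    intro T
    obtain ⟨θ, hθ, h⟩ := hpt ⟨T, hA T.2⟩
    obtain ⟨S, hS, -⟩ := hA.exists_finiteRankTrace_eq hθ T
    exact ⟨S, hS.trans (congrArg Subtype.val h).symm⟩
  choose ψ hψ using hmem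
  refine ⟨ψ, hψ, isAlgAut_or_isAlgAntiAut_of_trace isPrimeRing_finiteRank finiteRankTrace
    finiteRankTrace_mul_comm eq_zero_of_finiteRankTrace_mul ψ ?_ fun S T => ?_⟩
  -- A preimage `a` of `Q` under `φ` satisfies `Q = θ a`, so `a = θ' Q` already has finite rank.
  · rw [← top_le_iff, ← span_isRankOneIdempotent_eq_top]
    refine Submodule.span_mono fun Q hQ => ?_
    obtain ⟨a, ha⟩ := hrange Q hQ
    obtain ⟨θ, hθ, h⟩ := hpt a
    obtain ⟨θ', hθ', hl, -⟩ := hθ.exists_inverse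
    obtain ⟨S, hS, -⟩ := hA.exists_finiteRankTrace_eq hθ' Q
    have e : (⟨Q, hA Q.2⟩ : A) = θ a := Subtype.ext (ha.symm.trans (congrArg Subtype.val h))
    rw [e, hl] at hS
    refine ⟨S, Subtype.ext ?_⟩
    have e' : (⟨S, hA S.2⟩ : A) = a := Subtype.ext hS
    rw [hψ, e', ha]
  · obtain ⟨θ, hθ, h⟩ := hφ ⟨S, hA S.2⟩ ⟨T, hA T.2⟩
    obtain ⟨θF, h1, h2, h3⟩ := hA.exists_isAlgAut_finiteRank hθ
    refine ⟨θF, h1, h2, Subtype.ext ?_⟩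
    rw [h3]
    exact (congrArg₂ (· + ·) (hψ S) (hψ T)).trans (congrArg Subtype.val h)

/-- Finite rank operators are dense in a standard operator algebra in the weak operator topology. -/
theorem IsStandard.dense_finiteRank (hA : IsStandard A) :
    @Dense A (wot A) {T : A | (T : E →L[ℂ] E) ∈ finiteRank E} := by
  let := wot A
  intro T
  -- The net `T * P s`, over finite sets `s`, has finite rank and agrees with `T` at `x` once `x ∈
  -- s`.
  choose P hPW hPx using fun s : Finset E =>
    exists_projection_onto (Submodule.span ℂ (s : Set E))
  have hTP : ∀ s, (T : E →L[ℂ] E) * P s ∈ finiteRank E := fun s =>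
    mem_finiteRank_of_forall_mem ((Submodule.span ℂ (s : Set E)).map (T : E →L[ℂ] E).toLinearMap)
      fun x => ⟨P s x, hPW s x, rfl⟩
  refine mem_closure_of_tendsto (f := fun s => (⟨T * P s, hA (hTP s)⟩ : A)) (b := Filter.atTop) ?_
    (Filter.Eventually.of_forall hTP)
  have hind : Topology.IsInducing
    (fun T : A => (ContinuousLinearMapWOT.ofCLM (T : E →L[ℂ] E) : E →WOT[ℂ] E)) := ⟨rfl⟩
  rw [hind.tendsto_nhds_iff, ContinuousLinearMapWOT.tendsto_iff_forall_dual_apply_tendsto]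
  intro x y
  refine tendsto_const_nhds.congr' ?_
  filter_upwards [Filter.eventually_ge_atTop {x}] with s hs
  have : P s x = x := hPx s x (Submodule.subset_span (hs (Finset.mem_singleton_self x)))
  change y ((T : E →L[ℂ] E) x) = y ((T : E →L[ℂ] E) (P s x))
  rw [this]

end Standard

end OperatorAlgebra

namespace OperatorAlgebra

/-! ### Extension by weak operator continuity -/

section Continuity

/-- Two-variable identities extend from a dense set when both sides are separately continuous. -/
theorem eq_of_separately_continuous {X Y : Type*} [TopologicalSpace X] [TopologicalSpace Y]
    [T2Space Y] {s : Set X} (hs : Dense s) {F G : X → X → Y}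
    (hF₁ : ∀ a, Continuous (F a)) (hG₁ : ∀ a, Continuous (G a))
    (hF₂ : ∀ b, Continuous fun a => F a b) (hG₂ : ∀ b, Continuous fun a => G a b)
    (h : ∀ a ∈ s, ∀ b ∈ s, F a b = G a b) (a b : X) : F a b = G a b :=
  congrFun (Continuous.ext_on hs (hF₂ b) (hG₂ b) fun a' ha' =>
    congrFun (Continuous.ext_on hs (hF₁ a') (hG₁ a') (h a' ha')) b) a

variable {E : Type*} [NormedAddCommGroup E] [NormedSpace ℂ E]
  {A : NonUnitalSubalgebra ℂ (E →L[ℂ] E)}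

theorem isEmbedding_wot : @Topology.IsEmbedding A (E →WOT[ℂ] E) (wot A) _
    fun T => ContinuousLinearMapWOT.ofCLM (T : E →L[ℂ] E) :=
  letI := wot A
  ⟨⟨rfl⟩, fun _ _ h => Subtype.ext (ContinuousLinearMapWOT.ofCLM_injective h)⟩

/-- A map that is continuous in the weak operator topology and restricts to an automorphism or
anti-automorphism of the finite rank operators is a homomorphism or an anti-homomorphism. -/
theorem IsStandard.isAlgHom_or_isAlgAntiHom_of_continuous (hA : IsStandard A) {φ : A → A}
    {ψ : finiteRank E → finiteRank E}
    (hψ : ∀ T : finiteRank E,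
      (ψ T : E →L[ℂ] E) = (φ ⟨(T : E →L[ℂ] E), hA T.2⟩ : E →L[ℂ] E))
    (h : IsAlgHom ψ ∨ IsAlgAntiHom ψ) (hφ : Continuous[wot A, wot A] φ) :
    IsAlgHom φ ∨ IsAlgAntiHom φ := by
  let := wot A
  have hemb := isEmbedding_wot (A := A)
  have : T2Space A := hemb.t2Space
  have hι := hemb.continuous
  have hd := hA.dense_finiteRank
  have hadd : ∀ {f g : A → A}, Continuous f → Continuous g → Continuous fun x => f x + g x :=
    fun hf hg => hemb.continuous_iff.2 ((hι.comp hf).add (hι.comp hg))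
  have hsmul : ∀ {f : A → A} (c : ℂ), Continuous f → Continuous fun x => c • f x :=
    fun c hf => hemb.continuous_iff.2 ((hι.comp hf).const_smul c)
  -- Multiplication is in general only separately continuous here, so products are extended one
  -- variable at a time.
  have hmul₁ : ∀ {f : A → A} (a : A), Continuous f → Continuous fun x => a * f x :=
    fun a hf => hemb.continuous_iff.2
      ((continuous_const_mul (ContinuousLinearMapWOT.ofCLM (a : E →L[ℂ] E))).comp (hι.comp hf))
  have hmul₂ : ∀ {f : A → A} (a : A), Continuous f → Continuous fun x => f x * a :=
    fun a hf => hemb.continuous_iff.2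
      ((continuous_mul_const (ContinuousLinearMapWOT.ofCLM (a : E →L[ℂ] E))).comp (hι.comp hf))
  have hlin : IsLinearMap ℂ ψ → IsLinearMap ℂ φ := by
    intro hl
    constructor
    · refine eq_of_separately_continuous hd
        (fun a => hφ.comp (hadd continuous_const continuous_id))
        (fun a => hadd continuous_const hφ)
        (fun b => hφ.comp (hadd continuous_id continuous_const))
        (fun b => hadd hφ continuous_const) fun a ha b hb => Subtype.ext ?_
      have := congrArg Subtype.val (hl.map_add ⟨a, ha⟩ ⟨b, hb⟩)
      exact (hψ _).symm.trans (this.trans (congrArg₂ (· + ·) (hψ ⟨a, ha⟩) (hψ ⟨b, hb⟩)))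
    · intro c
      refine congrFun (Continuous.ext_on hd (hφ.comp (hsmul c continuous_id)) (hsmul c hφ)
        fun a ha => Subtype.ext ?_)
      have := congrArg Subtype.val (hl.map_smul c ⟨a, ha⟩)
      exact (hψ _).symm.trans (this.trans (congrArg (c • ·) (hψ ⟨a, ha⟩)))
  refine h.imp (fun h => ⟨hlin h.1, ?_⟩) (fun h => ⟨hlin h.1, ?_⟩)
  · refine eq_of_separately_continuous hd (fun a => hφ.comp (hmul₁ a continuous_id))
      (fun a => hmul₁ _ hφ) (fun b => hφ.comp (hmul₂ b continuous_id))
      (fun b => hmul₂ _ hφ) fun a ha b hb => Subtype.ext ?_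
    have := congrArg Subtype.val (h.2 ⟨a, ha⟩ ⟨b, hb⟩)
    exact (hψ _).symm.trans (this.trans (congrArg₂ (· * ·) (hψ ⟨a, ha⟩) (hψ ⟨b, hb⟩)))
  · refine eq_of_separately_continuous (G := fun a b => φ b * φ a) hd
      (fun a => hφ.comp (hmul₁ a continuous_id))
      (fun a => hmul₂ _ hφ) (fun b => hφ.comp (hmul₂ b continuous_id))
      (fun b => hmul₁ _ hφ) fun a ha b hb => Subtype.ext ?_
    have := congrArg Subtype.val (h.2 ⟨a, ha⟩ ⟨b, hb⟩)
    exact (hψ _).symm.trans (this.trans (congrArg₂ (· * ·) (hψ ⟨b, hb⟩) (hψ ⟨a, ha⟩)))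

end Continuity

end OperatorAlgebra

theorem proposition2p1 {E : Type*} [NormedAddCommGroup E] [NormedSpace ℂ E] [CompleteSpace E]
    (hdim : 3 ≤ Module.rank ℂ E)
    (A : NonUnitalSubalgebra ℂ (E →L[ℂ] E)) (hA : OperatorAlgebra.IsStandard A)
    (φ : A → A)
    (hrange : ∀ Q : E →L[ℂ] E, OperatorAlgebra.IsRankOneIdempotent Q →
      ∃ a : A, (φ a : E →L[ℂ] E) = Q)
    (hφ : ∀ a b : A, ∃ θ : A → A, OperatorAlgebra.IsAlgAut θ ∧ φ a + φ b = θ (a + b)) :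
    (∃ ψ : OperatorAlgebra.finiteRank E → OperatorAlgebra.finiteRank E,
        (∀ T : OperatorAlgebra.finiteRank E,
          (ψ T : E →L[ℂ] E) = (φ ⟨(T : E →L[ℂ] E), hA T.2⟩ : E →L[ℂ] E)) ∧
        (OperatorAlgebra.IsAlgAut ψ ∨ OperatorAlgebra.IsAlgAntiAut ψ)) ∧
      (Continuous[OperatorAlgebra.wot A, OperatorAlgebra.wot A] φ →
        OperatorAlgebra.IsAlgHom φ ∨ OperatorAlgebra.IsAlgAntiHom φ) := by
  obtain ⟨ψ, hψ, h⟩ := hA.exists_restrict_finiteRank φ hrange hφ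
  exact ⟨⟨ψ, hψ, h⟩, hA.isAlgHom_or_isAlgAntiHom_of_continuous hψ (h.imp And.left And.left)⟩
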